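/- Let $A$ be an associative (not necessarily commutative) semiring with $0$ and $1$; let $\otimes_A$ be the tensor product of a right and a left $A$-semimodule, i.e. the universal abelian monoid for biadditive $A$-balanced maps. Let $(\mathcal{C},\Delta,\varepsilon)$ be an $A$-semicoring, i.e. a comonoid in the monoidal category of $(A,A)$-bisemimodules with $\otimes_A$ (so $\Delta:\mathcal C\to\mathcal C\otimes_A\mathcal C$ and $\varepsilon:\mathcal C\to A$ are $(A,A)$-bilinear, coassociative and counital); write $\Delta(c)=\sum c_1\otimes_A c_2$. A submonoid $L$ of an abelian monoid $G$ is *subtractive* if $L=\{g\in G\mid g+l'=l''\text{ for some }l',l''\in L\}$. A morphism $f:G\to H$ of abelian monoids is *$i$-uniform* (or *subtractive*) if $f(G)$ is subtractive in $H$, *$k$-uniform* if $f(x)=f(y)$ implies $x+k=y+k'$ for some $k,k'\in G$ with $f(k)=f(k')=0$, and *uniform* if it is both. A left $A$-semimodule $M$ is *uniformly generated* if there are a set $\Lambda$ and a uniform surjective $A$-linear map $A^{(\Lambda)}\to M$. Let ${}^*\mathcal C=\mathrm{Hom}_{A-}(\mathcal C,A)$ be the left dual semiring, with product $(f\star g)(c)=\sum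 g(c_1f(c_2))$, unit $\varepsilon$, and right $A$-action $(fa)(c)=f(c)a$. For a right $A$-semimodule $M$ let $$\alpha^{\mathcal C}_M: M\otimes_A\mathcal C\to \mathrm{Hom}_{-A}({}^*\mathcal C,M),\qquad m\otimes_A c\mapsto [f\mapsto m f(c)].$$ Let $\mathbb S^{\mathcal C}$ be the category of right $\mathcal C$-semicomodules (right $A$-semimodules $M$ with a coassociative counital right $A$-linear coaction $\rho:M\to M\otimes_A\mathcal C$, $\rho(m)=\sum m_{0}\otimes_A m_{1}$) and $\mathcal C$-colinear maps, and let $\mathbb S_{{}^*\mathcal C}$ be the category of right ${}^*\mathcal C$-semimodules. There is an embedding $\iota:\mathbb S^{\mathcal C}\to\mathbb S_{{}^*\mathcal C}$, the identity on underlying monoids and maps, where $m\cdot f=\sum m_{0}f(m_{1})$. We write $\mathbb S^{\mathcal C}=\mathbb S_{{}^*\mathcal C}$ if $\iota$ is an isomorphism of categories, and say that $\mathbb S^{\mathcal C}$ is *closed under ${}^*\mathcal C$-subsemimodules* if for every right $\mathcal C$-semicomodule $M$ every ${}^*\mathcal C$-subsemimodule of $\iota(M)$ is of the form $\iota(N)$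 for some right $\mathcal C$-semicomodule $N$. **Theorem.** Assume that ${}_A\mathcal C$ is uniformly generated, that $\alpha^{\mathcal C}_M$ is subtractive for every right $A$-semimodule $M$, and that for every set $\Lambda$ the functor $A^{\Lambda}\otimes_A-$ from left $A$-semimodules to abelian monoids preserves $i$-uniform morphisms. Then $\mathbb S^{\mathcal C}=\mathbb S_{{}^*\mathcal C}$ if and only if ${}_A\mathcal C$ is finitely generated and projective and $\mathbb S^{\mathcal C}$ is closed under ${}^*\mathcal C$-subsemimodules. -/

import Mathlib

universe u v w

open MulOpposite

/-! Conventions. A right semimodule over a semiring `A` is a `Module Aᵐᵒᵖ M`, with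
`op a • m` standing for `m a`. An `(A, A)`-bisemimodule carries commuting
`Module A` and `Module Aᵐᵒᵖ` structures. -/

/-! ### Subtractive submonoids and uniform morphisms -/

/-- The subtractive closure `{g | g + l' = l'' for some l', l'' ∈ L}` of a submonoid. -/
def subtractiveClosure {G : Type u} [AddCommMonoid G] (L : AddSubmonoid G) : Set G :=
  {g | ∃ l' ∈ L, ∃ l'' ∈ L, g + l' = l''}

/-- A submonoid is subtractive iff it equals its subtractive closure. -/
def IsSubtractive {G : Type u} [AddCommMonoid G] (L : AddSubmonoid G) : Prop :=
  (L : Set G) = subtractiveClosure L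

/-- A morphism is `i`-uniform (also called subtractive) iff its image is subtractive. -/
def IUniform {G : Type u} {H : Type v} [AddCommMonoid G] [AddCommMonoid H] (f : G →+ H) : Prop :=
  IsSubtractive (AddMonoidHom.mrange f)

/-- A morphism is `k`-uniform iff `f x = f y` implies `x + k = y + k'` for some `k, k' ∈ Ker f`. -/
def KUniform {G : Type u} {H : Type v} [AddCommMonoid G] [AddCommMonoid H] (f : G →+ H) : Prop :=
  ∀ x y : G, f x = f y → ∃ k k' : G, f k = 0 ∧ f k' = 0 ∧ x + k = y + k'

/-- A left semimodule is uniformly generated iff it is the image of a surjective map from a free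
semimodule which is both `i`-uniform and `k`-uniform. -/
def UniformlyGenerated (A : Type u) (M : Type v) [Semiring A] [AddCommMonoid M] [Module A M] :
    Prop :=
  ∃ (Λ : Type v) (π : (Λ →₀ A) →ₗ[A] M),
    Function.Surjective π ∧ IUniform π.toAddMonoidHom ∧ KUniform π.toAddMonoidHom

/-! ### The tensor product over a not necessarily commutative semiring -/

/-- The relation `(m a) ⊗ n ∼ m ⊗ (a n)` on the tensor product of abelian monoids. -/
inductive Tens.Rel (A : Type u) (M : Type v) (N : Type w) [Semiring A] [AddCommMonoid M]
    [AddCommMonoid N] [Module Aᵐᵒᵖ M] [Module A N] :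
    TensorProduct ℕ M N → TensorProduct ℕ M N → Prop
  | balance (m : M) (a : A) (n : N) :
      Tens.Rel A M N (TensorProduct.tmul ℕ (op a • m) n) (TensorProduct.tmul ℕ m (a • n))

/-- The tensor product `M ⊗_A N` of a right and a left `A`-semimodule. -/
def Tens (A : Type u) (M : Type v) (N : Type w) [Semiring A] [AddCommMonoid M]
    [AddCommMonoid N] [Module Aᵐᵒᵖ M] [Module A N] : Type (max v w) :=
  (addConGen (Tens.Rel A M N)).Quotient

namespace Tens

section basic

variable {A : Type u} [Semiring A]
variable {M M' M'' N N' N'' : Type*} [AddCommMonoid M] [AddCommMonoid M'] [AddCommMonoid M'']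
  [AddCommMonoid N] [AddCommMonoid N'] [AddCommMonoid N'']
  [Module Aᵐᵒᵖ M] [Module Aᵐᵒᵖ M'] [Module Aᵐᵒᵖ M'']
  [Module A N] [Module A N'] [Module A N'']
variable {P : Type*} [AddCommMonoid P]

instance : AddCommMonoid (Tens A M N) :=
  inferInstanceAs (AddCommMonoid (addConGen (Tens.Rel A M N)).Quotient)

variable (A) in
/-- The pure tensor `m ⊗ n`. -/
def tmul (m : M) (n : N) : Tens A M N :=
  (addConGen (Tens.Rel A M N)).mk' (TensorProduct.tmul ℕ m n)

theorem add_tmul (m m' : M) (n : N) : tmul A (m + m') n = tmul A m n + tmul A m' n := by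
  unfold tmul
  rw [TensorProduct.add_tmul, map_add]
  rfl

theorem tmul_add (m : M) (n n' : N) : tmul A m (n + n') = tmul A m n + tmul A m n' := by
  unfold tmul
  rw [TensorProduct.tmul_add, map_add]
  rfl

theorem zero_tmul (n : N) : tmul A (0 : M) n = 0 := by
  unfold tmul
  rw [TensorProduct.zero_tmul, map_zero]
  rfl

theorem tmul_zero (m : M) : tmul A m (0 : N) = 0 := by
  unfold tmul
  rw [TensorProduct.tmul_zero, map_zero]
  rfl

theorem smul_tmul (m : M) (a : A) (n : N) : tmul A (op a • m) n = tmul A m (a • n) :=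
  (AddCon.eq _).2 (AddConGen.Rel.of _ _ (Rel.balance m a n))

@[elab_as_elim]
theorem induction_on {p : Tens A M N → Prop} (t : Tens A M N) (zero : p 0)
    (tmul : ∀ m n, p (tmul A m n)) (add : ∀ x y, p x → p y → p (x + y)) : p t := by
  refine AddCon.induction_on t fun x => ?_
  induction x using TensorProduct.induction_on with
  | zero => exact zero
  | tmul m n => exact tmul m n
  | add x y hx hy => exact add _ _ hx hy

theorem addHom_ext {f g : Tens A M N →+ P} (h : ∀ m n, f (tmul A m n) = g (tmul A m n)) :
    f = g := by
  ext t
  induction t using induction_on with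
  | zero => simp
  | tmul m n => exact h m n
  | add x y hx hy => rw [map_add, map_add, hx, hy]

/-- The additive map on `M ⊗_A N` induced by a biadditive balanced map. -/
def lift (f : M →+ N →+ P) (hf : ∀ m (a : A) n, f (op a • m) n = f m (a • n)) :
    Tens A M N →+ P :=
  (addConGen (Tens.Rel A M N)).lift
    (TensorProduct.liftAddHom (R := ℕ) f (fun r m n => by simp))
    (AddCon.addConGen_le.2 (by
      rintro _ _ ⟨m, a, n⟩
      exact hf m a n))

@[simp]
theorem lift_tmul (f : M →+ N →+ P) (hf : ∀ m (a : A) n, f (op a • m) n = f m (a • n))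
    (m : M) (n : N) : lift f hf (tmul A m n) = f m n := rfl

/-- `m ↦ (n ↦ m ⊗ n)` as a biadditive map. -/
def mkHom : M →+ N →+ Tens A M N where
  toFun m := { toFun := fun n => tmul A m n, map_zero' := tmul_zero m, map_add' := tmul_add m }
  map_zero' := by ext n; exact zero_tmul n
  map_add' m m' := by ext n; exact add_tmul m m' n

/-- The functorial map `f ⊗_A g`. -/
def map (f : M →ₗ[Aᵐᵒᵖ] M') (g : N →ₗ[A] N') : Tens A M N →+ Tens A M' N' :=
  lift ((mkHom.comp f.toAddMonoidHom).compl₂ g.toAddMonoidHom) (fun m a n => by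
    change tmul A (f (op a • m)) (g n) = tmul A (f m) (g (a • n))
    rw [f.map_smul, g.map_smul, smul_tmul])

@[simp]
theorem map_tmul (f : M →ₗ[Aᵐᵒᵖ] M') (g : N →ₗ[A] N') (m : M) (n : N) :
    map f g (tmul A m n) = tmul A (f m) (g n) := rfl

theorem map_id : map (LinearMap.id : M →ₗ[Aᵐᵒᵖ] M) (LinearMap.id : N →ₗ[A] N) =
    AddMonoidHom.id _ :=
  addHom_ext fun _ _ => rfl

theorem map_map (f : M →ₗ[Aᵐᵒᵖ] M') (f' : M' →ₗ[Aᵐᵒᵖ] M'') (g : N →ₗ[A] N')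
    (g' : N' →ₗ[A] N'') (t : Tens A M N) :
    map f' g' (map f g t) = map (f' ∘ₗ f) (g' ∘ₗ g) t :=
  DFunLike.congr_fun (addHom_ext (f := (map f' g').comp (map f g))
    (g := map (f' ∘ₗ f) (g' ∘ₗ g)) fun _ _ => rfl) t

end basic

section actions

variable {A : Type u} [Semiring A]
variable {M M' N N' P : Type*} [AddCommMonoid M] [AddCommMonoid M'] [AddCommMonoid N]
  [AddCommMonoid N'] [AddCommMonoid P]
  [Module Aᵐᵒᵖ M] [Module Aᵐᵒᵖ M'] [Module A N] [Module A N'] [Module A P]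

section left

variable [Module A M] [SMulCommClass A Aᵐᵒᵖ M]

/-- Left multiplication by `a` as a right linear map. -/
def lmul (M : Type*) [AddCommMonoid M] [Module A M] [Module Aᵐᵒᵖ M] [SMulCommClass A Aᵐᵒᵖ M]
    (a : A) : M →ₗ[Aᵐᵒᵖ] M where
  toFun m := a • m
  map_add' := smul_add a
  map_smul' b m := smul_comm a b m

/-- The left action `a (m ⊗ n) = (a m) ⊗ n`. -/
instance : SMul A (Tens A M N) := ⟨fun a t => map (lmul M a) LinearMap.id t⟩

theorem smul_tmul_left (a : A) (m : M) (n : N) : a • tmul A m n = tmul A (a • m) n := rfl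

theorem smul_add_left (a : A) (x y : Tens A M N) : a • (x + y) = a • x + a • y :=
  map_add (map (lmul M a) LinearMap.id) x y

theorem smul_zero_left (a : A) : a • (0 : Tens A M N) = 0 :=
  map_zero (map (lmul M a) LinearMap.id)

instance : Module A (Tens A M N) where
  smul_zero := smul_zero_left
  smul_add := smul_add_left
  one_smul t := by
    induction t using induction_on with
    | zero => exact smul_zero_left _
    | tmul m n => rw [smul_tmul_left, one_smul]
    | add x y hx hy => rw [smul_add_left, hx, hy]
  mul_smul a b t := by
    induction t using induction_on with
    | zero => simp only [smul_zero_left]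
    | tmul m n => simp only [smul_tmul_left, mul_smul]
    | add x y hx hy => simp only [smul_add_left, hx, hy]
  zero_smul t := by
    induction t using induction_on with
    | zero => exact smul_zero_left _
    | tmul m n => rw [smul_tmul_left, zero_smul, zero_tmul]
    | add x y hx hy => rw [smul_add_left, hx, hy, add_zero]
  add_smul a b t := by
    induction t using induction_on with
    | zero => simp only [smul_zero_left, add_zero]
    | tmul m n => simp only [smul_tmul_left, add_smul, add_tmul]
    | add x y hx hy => rw [smul_add_left, hx, hy, smul_add_left, smul_add_left]; abel

end left

section right

variable [Module Aᵐᵒᵖ N] [SMulCommClass A Aᵐᵒᵖ N]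

/-- Right multiplication by `a` as a left linear map. -/
def rmul (N : Type*) [AddCommMonoid N] [Module A N] [Module Aᵐᵒᵖ N] [SMulCommClass A Aᵐᵒᵖ N]
    (a : Aᵐᵒᵖ) : N →ₗ[A] N where
  toFun n := a • n
  map_add' := smul_add a
  map_smul' b n := (smul_comm b a n).symm

/-- The right action `(m ⊗ n) a = m ⊗ (n a)`. -/
instance : SMul Aᵐᵒᵖ (Tens A M N) := ⟨fun a t => map LinearMap.id (rmul N a) t⟩

theorem smul_tmul_right (a : Aᵐᵒᵖ) (m : M) (n : N) : a • tmul A m n = tmul A m (a • n) := rfl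

theorem smul_add_right (a : Aᵐᵒᵖ) (x y : Tens A M N) : a • (x + y) = a • x + a • y :=
  map_add (map LinearMap.id (rmul N a)) x y

theorem smul_zero_right (a : Aᵐᵒᵖ) : a • (0 : Tens A M N) = 0 :=
  map_zero (map LinearMap.id (rmul N a))

instance : Module Aᵐᵒᵖ (Tens A M N) where
  smul_zero := smul_zero_right
  smul_add := smul_add_right
  one_smul t := by
    induction t using induction_on with
    | zero => exact smul_zero_right _
    | tmul m n => rw [smul_tmul_right, one_smul]
    | add x y hx hy => rw [smul_add_right, hx, hy]
  mul_smul a b t := by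
    induction t using induction_on with
    | zero => simp only [smul_zero_right]
    | tmul m n => simp only [smul_tmul_right, mul_smul]
    | add x y hx hy => simp only [smul_add_right, hx, hy]
  zero_smul t := by
    induction t using induction_on with
    | zero => exact smul_zero_right _
    | tmul m n => rw [smul_tmul_right, zero_smul, tmul_zero]
    | add x y hx hy => rw [smul_add_right, hx, hy, add_zero]
  add_smul a b t := by
    induction t using induction_on with
    | zero => simp only [smul_zero_right, add_zero]
    | tmul m n => simp only [smul_tmul_right, add_smul, tmul_add]
    | add x y hx hy => rw [smul_add_right, hx, hy, smul_add_right, smul_add_right]; abel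

end right

instance [Module A M] [SMulCommClass A Aᵐᵒᵖ M] [Module Aᵐᵒᵖ N] [SMulCommClass A Aᵐᵒᵖ N] :
    SMulCommClass A Aᵐᵒᵖ (Tens A M N) where
  smul_comm a b t := by
    induction t using induction_on with
    | zero => simp only [smul_zero]
    | tmul m n => rfl
    | add x y hx hy => simp only [smul_add, hx, hy]

/-- The canonical isomorphism `M ⊗_A A ≅ M`, `m ⊗ a ↦ m a`, as an additive map. -/
def rid : Tens A M A →+ M :=
  lift
    { toFun := fun m =>
        { toFun := fun a => op a • m
          map_zero' := by rw [op_zero, zero_smul]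
          map_add' := fun a b => by rw [MulOpposite.op_add, add_smul] }
      map_zero' := by ext a; exact smul_zero _
      map_add' := fun m m' => by ext a; exact smul_add _ m m' }
    (fun m a b => by
      change op b • op a • m = op (a * b) • m
      rw [op_mul, mul_smul])

@[simp]
theorem rid_tmul (m : M) (a : A) : rid (tmul A m a) = op a • m := rfl

/-- The canonical isomorphism `A ⊗_A N ≅ N`, `a ⊗ n ↦ a n`, as an additive map. -/
def lid : Tens A A N →+ N :=
  lift
    { toFun := fun a =>
        { toFun := fun n => a • n
          map_zero' := smul_zero a
          map_add' := smul_add a }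
      map_zero' := by ext n; exact zero_smul A n
      map_add' := fun a b => by ext n; exact add_smul a b n }
    (fun b a n => by
      change (b * a) • n = b • a • n
      rw [mul_smul])

@[simp]
theorem lid_tmul (a : A) (n : N) : lid (tmul A a n) = a • n := rfl

section assoc

variable [Module Aᵐᵒᵖ N] [SMulCommClass A Aᵐᵒᵖ N]

/-- `n ↦ n ⊗ p` as a left linear map. -/
def tmulRight (p : P) : N →ₗ[A] Tens A N P where
  toFun n := tmul A n p
  map_add' n n' := add_tmul n n' p
  map_smul' _ _ := rfl

/-- `n ↦ m ⊗ n` as a right linear map. -/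
def tmulLeft (m : M) : N →ₗ[Aᵐᵒᵖ] Tens A M N where
  toFun n := tmul A m n
  map_add' := tmul_add m
  map_smul' _ _ := rfl

/-- `(m ⊗ n) ⊗ p ↦ m ⊗ (n ⊗ p)`. -/
def assocHom : Tens A (Tens A M N) P →+ Tens A M (Tens A N P) :=
  lift
    { toFun := fun t =>
        { toFun := fun p => map LinearMap.id (tmulRight p) t
          map_zero' := by
            induction t using induction_on with
            | zero => exact map_zero _
            | tmul m n => exact (congrArg (tmul A m) (tmul_zero n)).trans (tmul_zero m)
            | add x y hx hy => rw [map_add, hx, hy, add_zero]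
          map_add' := fun p p' => by
            induction t using induction_on with
            | zero => simp only [map_zero, add_zero]
            | tmul m n => exact (congrArg (tmul A m) (tmul_add n p p')).trans (tmul_add m _ _)
            | add x y hx hy => simp only [map_add, hx, hy]; abel }
      map_zero' := by ext p; exact map_zero (map LinearMap.id (tmulRight p))
      map_add' := fun t t' => by ext p; exact map_add (map LinearMap.id (tmulRight p)) t t' }
    (fun t a p => by
      change map LinearMap.id (tmulRight p) (op a • t) = map LinearMap.id (tmulRight (a • p)) t
      induction t using induction_on with
      | zero => simp only [smul_zero, map_zero]
      | tmul m n => exact congrArg (tmul A m) (smul_tmul n a p)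
      | add x y hx hy => simp only [smul_add, map_add, hx, hy])

/-- `m ⊗ (n ⊗ p) ↦ (m ⊗ n) ⊗ p`. -/
def assocInv : Tens A M (Tens A N P) →+ Tens A (Tens A M N) P :=
  lift
    { toFun := fun m => map (tmulLeft m) LinearMap.id
      map_zero' := addHom_ext fun n p => by
        exact (congrArg (fun z => tmul A z p) (zero_tmul n)).trans (zero_tmul p)
      map_add' := fun m m' => addHom_ext fun n p => by
        exact (congrArg (fun z => tmul A z p) (add_tmul m m' n)).trans (add_tmul _ _ p) }
    (fun m a t => by
      change map (tmulLeft (op a • m)) LinearMap.id t = map (tmulLeft m) LinearMap.id (a • t)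
      induction t using induction_on with
      | zero => simp only [smul_zero, map_zero]
      | tmul n p => exact congrArg (fun z => tmul A z p) (smul_tmul m a n)
      | add x y hx hy => simp only [smul_add, map_add, hx, hy])

/-- The associativity isomorphism `(M ⊗_A N) ⊗_A P ≅ M ⊗_A (N ⊗_A P)`. -/
def assoc : Tens A (Tens A M N) P ≃+ Tens A M (Tens A N P) :=
  AddMonoidHom.toAddEquiv assocHom assocInv
    (addHom_ext fun t p => by
      induction t using induction_on with
      | zero => rw [zero_tmul, map_zero, map_zero]
      | tmul m n => rfl
      | add x y hx hy => rw [add_tmul, map_add, map_add, hx, hy])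
    (addHom_ext fun m t => by
      induction t using induction_on with
      | zero => rw [tmul_zero, map_zero, map_zero]
      | tmul n p => rfl
      | add x y hx hy => rw [tmul_add, map_add, map_add, hx, hy])

theorem assoc_tmul (m : M) (n : N) (p : P) :
    assoc (tmul A (tmul A m n) p) = tmul A m (tmul A n p) := rfl

end assoc

/-- `m ⊗ n ↦ m f(n)` for a left linear functional `f` on `N`. -/
def ev (M : Type*) [AddCommMonoid M] [Module Aᵐᵒᵖ M] (f : N →ₗ[A] A) : Tens A M N →+ M :=
  rid.comp (map LinearMap.id f)

@[simp]
theorem ev_tmul (f : N →ₗ[A] A) (m : M) (n : N) : ev M f (tmul A m n) = op (f n) • m := rfl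

theorem ev_smul_left [Module A M] [SMulCommClass A Aᵐᵒᵖ M] (f : N →ₗ[A] A) (a : A)
    (t : Tens A M N) : ev M f (a • t) = a • ev M f t := by
  induction t using induction_on with
  | zero => simp only [smul_zero, map_zero]
  | tmul m n => exact (smul_comm a (op (f n)) m).symm
  | add x y hx hy => simp only [smul_add, map_add, hx, hy]

theorem ev_map (f : N →ₗ[A] A) (h : M →ₗ[Aᵐᵒᵖ] M') (t : Tens A M N) :
    ev M' f (map h LinearMap.id t) = h (ev M f t) := by
  induction t using induction_on with
  | zero => simp only [map_zero]
  | tmul m n => exact (h.map_smul _ _).symm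
  | add x y hx hy => simp only [map_add, hx, hy]

theorem ev_add (f g : N →ₗ[A] A) (t : Tens A M N) : ev M (f + g) t = ev M f t + ev M g t := by
  induction t using induction_on with
  | zero => simp only [map_zero, add_zero]
  | tmul m n => exact (congrArg (· • m) (MulOpposite.op_add (f n) (g n))).trans (add_smul _ _ _)
  | add x y hx hy => simp only [map_add, hx, hy]; abel

theorem ev_zero (t : Tens A M N) : ev M (0 : N →ₗ[A] A) t = 0 := by
  induction t using induction_on with
  | zero => simp only [map_zero]
  | tmul m n => exact zero_smul Aᵐᵒᵖ m
  | add x y hx hy => simp only [map_add, hx, hy, add_zero]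

theorem ev_smul (f : N →ₗ[A] A) (a : Aᵐᵒᵖ) (t : Tens A M N) :
    ev M (a • f) t = a • ev M f t := by
  induction t using induction_on with
  | zero => simp only [map_zero, smul_zero]
  | tmul m n => exact mul_smul a (op (f n)) m
  | add x y hx hy => simp only [map_add, hx, hy, smul_add]

end actions

end Tens

/-! ### Semicorings -/

/-- The comultiplication and counit of an `A`-semicoring, both `(A, A)`-bilinear. -/
class SemicoringStruct (A : Type u) (C : Type v) [Semiring A] [AddCommMonoid C] [Module A C]
    [Module Aᵐᵒᵖ C] [SMulCommClass A Aᵐᵒᵖ C] where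
  comul : C →ₗ[A] Tens A C C
  comul_smul_right : ∀ (a : Aᵐᵒᵖ) (c : C), comul (a • c) = a • comul c
  counit : C →ₗ[A] A
  counit_smul_right : ∀ (a : Aᵐᵒᵖ) (c : C), counit (a • c) = a • counit c

namespace SemicoringStruct

variable (A : Type u) (C : Type v) [Semiring A] [AddCommMonoid C] [Module A C]
  [Module Aᵐᵒᵖ C] [SMulCommClass A Aᵐᵒᵖ C] [SemicoringStruct A C]

/-- The comultiplication as a right linear map. -/
def comulR : C →ₗ[Aᵐᵒᵖ] Tens A C C where
  toFun := comul (A := A)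
  map_add' := map_add _
  map_smul' := comul_smul_right

/-- The counit as a right linear map. -/
def counitR : C →ₗ[Aᵐᵒᵖ] A where
  toFun := counit (A := A)
  map_add' := map_add _
  map_smul' := counit_smul_right

end SemicoringStruct

open SemicoringStruct

/-- An `A`-semicoring: a coassociative counital comonoid in `(A, A)`-bisemimodules. -/
class Semicoring (A : Type u) (C : Type v) [Semiring A] [AddCommMonoid C] [Module A C]
    [Module Aᵐᵒᵖ C] [SMulCommClass A Aᵐᵒᵖ C] extends SemicoringStruct A C where
  coassoc : ∀ c : C,
    Tens.assoc (Tens.map (comulR A C) LinearMap.id (comul c)) =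
      Tens.map LinearMap.id comul (comul c)
  counit_left : ∀ c : C, Tens.lid (Tens.map (counitR A C) LinearMap.id (comul c)) = c
  counit_right : ∀ c : C, Tens.rid (Tens.map LinearMap.id counit (comul c)) = c

/-! ### The left dual semiring -/

/-- The left dual `*C = Hom_{A-}(C, A)`. -/
def LeftDual (A : Type u) (C : Type v) [Semiring A] [AddCommMonoid C] [Module A C] :
    Type (max u v) :=
  C →ₗ[A] A

namespace LeftDual

section

variable {A : Type u} {C : Type v} [Semiring A] [AddCommMonoid C] [Module A C]

instance : AddCommMonoid (LeftDual A C) := inferInstanceAs (AddCommMonoid (C →ₗ[A] A))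

/-- The right action `(f a)(c) = f(c) a`. -/
instance : Module Aᵐᵒᵖ (LeftDual A C) := inferInstanceAs (Module Aᵐᵒᵖ (C →ₗ[A] A))

/-- The underlying left linear functional. -/
def toLin (f : LeftDual A C) : C →ₗ[A] A := f

@[ext]
theorem ext {f g : LeftDual A C} (h : ∀ c, f.toLin c = g.toLin c) : f = g :=
  LinearMap.ext h

end

variable {A : Type u} {C : Type v} [Semiring A] [AddCommMonoid C] [Module A C]
  [Module Aᵐᵒᵖ C] [SMulCommClass A Aᵐᵒᵖ C] [Semicoring A C]

/-- `c ↦ ∑ c₁ f(c₂)`. -/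
def hit (f : LeftDual A C) : C →ₗ[A] C where
  toFun c := Tens.ev C f.toLin (comul (A := A) c)
  map_add' c c' := by rw [map_add, map_add]
  map_smul' a c := by rw [map_smul, Tens.ev_smul_left]; rfl

/-- The product `(f ⋆ g)(c) = ∑ g(c₁ f(c₂))`. -/
instance : Mul (LeftDual A C) := ⟨fun f g => g.toLin ∘ₗ hit f⟩

/-- The unit of `*C` is the counit of `C`. -/
instance : One (LeftDual A C) := ⟨counit (A := A) (C := C)⟩

theorem mul_apply (f g : LeftDual A C) (c : C) : (f * g).toLin c = g.toLin (hit f c) := rfl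

theorem one_apply (c : C) : (1 : LeftDual A C).toLin c = counit (A := A) c := rfl

/-- `c ↦ ∑ c₁ f(c₂)` is compatible with any coassociative right linear map into `M ⊗_A C`. -/
theorem ev_mul {M : Type*} [AddCommMonoid M] [Module Aᵐᵒᵖ M] (ρ : M →ₗ[Aᵐᵒᵖ] Tens A M C)
    (hρ : ∀ m, Tens.assoc (Tens.map ρ LinearMap.id (ρ m)) =
      Tens.map LinearMap.id (comul (A := A)) (ρ m))
    (f g : LeftDual A C) (m : M) :
    Tens.ev M (f * g).toLin (ρ m) = Tens.ev M g.toLin (ρ (Tens.ev M f.toLin (ρ m))) := by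
  let e : Tens A C C →ₗ[A] C :=
    { toFun := Tens.ev C f.toLin
      map_add' := map_add _
      map_smul' := fun a t => Tens.ev_smul_left f.toLin a t }
  have h1 : ∀ t : Tens A M C, Tens.ev M (f * g).toLin t =
      Tens.ev M (g.toLin ∘ₗ e) (Tens.map LinearMap.id (comul (A := A)) t) := by
    intro t
    induction t using Tens.induction_on with
    | zero => simp only [map_zero]
    | tmul m c => rfl
    | add x y hx hy => simp only [map_add, hx, hy]
  have h2 : ∀ s : Tens A (Tens A M C) C,
      Tens.ev M g.toLin (Tens.ev (Tens A M C) f.toLin s) =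
        Tens.ev M (g.toLin ∘ₗ e) (Tens.assoc s) := by
    intro s
    induction s using Tens.induction_on with
    | zero => simp only [map_zero]
    | tmul t c =>
      induction t using Tens.induction_on with
      | zero => simp only [Tens.zero_tmul, map_zero]
      | tmul m c' => rfl
      | add x y hx hy => simp only [Tens.add_tmul, map_add, hx, hy]
    | add x y hx hy => simp only [map_add, hx, hy]
  rw [h1, ← hρ, ← h2, Tens.ev_map]

theorem hit_mul (f g : LeftDual A C) (c : C) : hit (f * g) c = hit g (hit f c) :=
  ev_mul (comulR A C) Semicoring.coassoc f g c

theorem hit_one (c : C) : hit (1 : LeftDual A C) c = c := Semicoring.counit_right c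

theorem counit_hit (f : LeftDual A C) (c : C) : counit (A := A) (hit f c) = f.toLin c := by
  have h : ∀ t : Tens A C C, counit (A := A) (Tens.ev C f.toLin t) =
      f.toLin (Tens.lid (Tens.map (counitR A C) LinearMap.id t)) := by
    intro t
    induction t using Tens.induction_on with
    | zero => simp only [map_zero]
    | tmul c c' =>
      change counit (A := A) (op (f.toLin c') • c) = f.toLin (counit (A := A) c • c')
      rw [counit_smul_right, map_smul]
      rfl
    | add x y hx hy => simp only [map_add, hx, hy]
  exact (h _).trans (congrArg f.toLin (Semicoring.counit_left c))

/-- The semiring `*C` with the product `⋆`. -/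
instance : Semiring (LeftDual A C) where
  __ := (inferInstance : AddCommMonoid (LeftDual A C))
  mul_assoc f g h := by ext c; simp only [mul_apply, hit_mul]
  one_mul f := by ext c; rw [mul_apply, hit_one]
  mul_one f := by ext c; rw [mul_apply]; exact counit_hit f c
  left_distrib f g h := by ext c; rfl
  right_distrib f g h := by
    ext c
    change h.toLin (Tens.ev C (f.toLin + g.toLin) (comul (A := A) c)) = _
    rw [Tens.ev_add, map_add]
    rfl
  zero_mul f := by
    ext c
    change f.toLin (Tens.ev C 0 (comul (A := A) c)) = _
    rw [Tens.ev_zero, map_zero]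
    rfl
  mul_zero f := by ext c; rfl

end LeftDual

/-! ### The canonical maps `α_M` -/

/-- `α_M : M ⊗_A C → Hom_{-A}(*C, M)`, `m ⊗ c ↦ (f ↦ m f(c))`. -/
def alphaMap (A : Type u) (C : Type v) (M : Type w) [Semiring A] [AddCommMonoid C] [Module A C]
    [AddCommMonoid M] [Module Aᵐᵒᵖ M] : Tens A M C →+ (LeftDual A C →ₗ[Aᵐᵒᵖ] M) where
  toFun t :=
    { toFun := fun f => Tens.ev M f.toLin t
      map_add' := fun f g => Tens.ev_add f.toLin g.toLin t
      map_smul' := fun a f => Tens.ev_smul f.toLin a t }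
  map_zero' := by ext f; exact map_zero (Tens.ev M f.toLin)
  map_add' t t' := by ext f; exact map_add (Tens.ev M f.toLin) t t'

/-! ### Right semicomodules -/

/-- A right `C`-semicomodule: a right `A`-semimodule with a coassociative counital coaction. -/
structure Semicomod (A : Type u) (C : Type v) [Semiring A] [AddCommMonoid C] [Module A C]
    [Module Aᵐᵒᵖ C] [SMulCommClass A Aᵐᵒᵖ C] [Semicoring A C] where
  carrier : Type w
  [isAddCommMonoid : AddCommMonoid carrier]
  [isModule : Module Aᵐᵒᵖ carrier]
  coact : carrier →ₗ[Aᵐᵒᵖ] Tens A carrier C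
  coassoc : ∀ m, Tens.assoc (Tens.map coact LinearMap.id (coact m)) =
    Tens.map LinearMap.id (comul (A := A)) (coact m)
  counit : ∀ m, Tens.rid (Tens.map LinearMap.id (SemicoringStruct.counit (A := A)) (coact m)) = m

attribute [instance] Semicomod.isAddCommMonoid Semicomod.isModule

namespace Semicomod

variable {A : Type u} {C : Type v} [Semiring A] [AddCommMonoid C] [Module A C]
  [Module Aᵐᵒᵖ C] [SMulCommClass A Aᵐᵒᵖ C] [Semicoring A C]

/-- A `C`-colinear map. -/
@[ext]
structure Hom (M N : Semicomod.{u, v, w} A C) where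
  toLin : M.carrier →ₗ[Aᵐᵒᵖ] N.carrier
  colinear : ∀ m, N.coact (toLin m) = Tens.map toLin LinearMap.id (M.coact m)

/-- The category `𝕊^C` of right `C`-semicomodules and `C`-colinear maps. -/
instance : CategoryTheory.Category (Semicomod.{u, v, w} A C) where
  Hom M N := Hom M N
  id M := ⟨LinearMap.id, fun m => by rw [Tens.map_id]; rfl⟩
  comp f g := ⟨g.toLin ∘ₗ f.toLin, fun m => by
    rw [LinearMap.comp_apply, g.colinear, f.colinear, Tens.map_map]; rfl⟩

/-- The right `*C`-semimodule structure `m f = ∑ m₀ f(m₁)` of a right `C`-semicomodule. -/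
@[reducible]
def dualModule (M : Semicomod.{u, v, w} A C) : Module (LeftDual A C)ᵐᵒᵖ M.carrier where
  smul f m := Tens.ev M.carrier f.unop.toLin (M.coact m)
  one_smul m := M.counit m
  mul_smul f g m := LeftDual.ev_mul M.coact M.coassoc g.unop f.unop m
  smul_zero _ := (congrArg _ (map_zero M.coact)).trans (map_zero _)
  smul_add _ m m' := (congrArg _ (map_add M.coact m m')).trans (map_add _ _ _)
  add_smul f g m := Tens.ev_add f.unop.toLin g.unop.toLin (M.coact m)
  zero_smul m := Tens.ev_zero (M.coact m)

/-- The right `*C`-semimodule underlying a right `C`-semicomodule. -/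
def toDualObj (M : Semicomod.{u, v, w} A C) : SemimoduleCat.{w} (LeftDual A C)ᵐᵒᵖ :=
  letI := M.dualModule
  SemimoduleCat.of (LeftDual A C)ᵐᵒᵖ M.carrier

variable (A C) in
/-- The embedding `𝕊^C ⥤ 𝕊_{*C}`, which is the identity on underlying sets and maps. -/
def toDual : CategoryTheory.Functor (Semicomod.{u, v, w} A C)
    (SemimoduleCat.{w} (LeftDual A C)ᵐᵒᵖ) where
  obj M := M.toDualObj
  map {M N} f :=
    letI := M.dualModule
    letI := N.dualModule
    SemimoduleCat.ofHom
      { toFun := f.toLin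
        map_add' := map_add f.toLin
        map_smul' := fun h m =>
          ((congrArg _ (f.colinear m)).trans
            (Tens.ev_map h.unop.toLin f.toLin (M.coact m))).symm }
  map_id _ := rfl
  map_comp _ _ := rfl

variable (A C) in
/-- `𝕊^C = 𝕊_{*C}`: the embedding `𝕊^C ⥤ 𝕊_{*C}` is an isomorphism of categories, that is, it is
bijective on objects and on morphisms. -/
def EqDual : Prop :=
  Function.Bijective (toDual.{u, v, w} A C).obj ∧
    ∀ M N : Semicomod.{u, v, w} A C,
      Function.Bijective ((toDual.{u, v, w} A C).map : (M ⟶ N) → _)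

variable (A C) in
/-- `𝕊^C` is closed under `*C`-subsemimodules: every `*C`-subsemimodule of (the `*C`-semimodule
underlying) a right `C`-semicomodule is itself the `*C`-semimodule underlying a right
`C`-semicomodule. -/
def ClosedUnderSub : Prop :=
  ∀ (M : Semicomod.{u, v, w} A C)
    (L : Submodule (LeftDual A C)ᵐᵒᵖ ((toDual.{u, v, w} A C).obj M)),
    ∃ N : Semicomod.{u, v, w} A C,
      (toDual.{u, v, w} A C).obj N = SemimoduleCat.of (LeftDual A C)ᵐᵒᵖ L

end Semicomod

/-! The bridge is a finite dual basis `e i`, `x i` of `C` as a left `A`-semimodule. Having one is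
equivalent to being finitely generated and projective.

Given a dual basis, a tensor `t` in `M ⊗_A C` equals `∑ t(eᵢ) ⊗ xᵢ`, where `t(f)` is its evaluation
at `f`, so tensors are determined by their evaluations (`Tens.ev_ext`). The only possible coaction
inducing a given `*C`-action is therefore `m ↦ ∑ m eᵢ ⊗ xᵢ`. Its evaluation at `f` is `m f`
(`ev_dualCoact`), which turns coassociativity, counitality and colinearity into the corresponding
statements about the action.

Conversely, if `𝕊^C = 𝕊_{*C}`, then `*C` and `Hom_{-A}(*C, A)` carry coactions. The first, applied
to `ε`, writes every functional as `f = ∑ eᵢ f(xᵢ)`, so `c` and `∑ eᵢ(c) xᵢ` have the same value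
under every functional. The second gives a left inverse of `C → Hom_{-A}(*C, A)`
(`EqDual.separating`), so these two elements are equal. Closure under subsemimodules follows from
surjectivity on objects. -/

open SemicoringStruct

/-! ### Dual bases -/

/-- A finite dual basis `c = ∑ i, e i c • x i` of a left semimodule. -/
def IsDualBasis {A : Type*} {C : Type*} [Semiring A] [AddCommMonoid C] [Module A C]
    {ι : Type*} [Fintype ι] (e : ι → LeftDual A C) (x : ι → C) : Prop :=
  ∀ c, ∑ i, (e i).toLin c • x i = c

/-- Projectivity splits a surjection `Aⁿ → C`. The coordinates of the section are the `e i`, and the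
images of the standard basis are the `x i`. -/
theorem exists_isDualBasis (A : Type*) (C : Type*) [Semiring A] [AddCommMonoid C] [Module A C]
    [Module.Finite A C] [Module.Projective A C] :
    ∃ (n : ℕ) (e : Fin n → LeftDual A C) (x : Fin n → C), IsDualBasis e x := by
  obtain ⟨n, π, hπ⟩ := Module.Finite.exists_fin' A C
  obtain ⟨s, hs⟩ := Module.projective_lifting_property π LinearMap.id hπ
  refine ⟨n, fun i => (LinearMap.proj i : (Fin n → A) →ₗ[A] A) ∘ₗ s,
    fun i => π (Pi.single i 1), fun c => ?_⟩
  change ∑ i, s c i • π (Pi.single i 1) = c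
  have h : π (s c) = c := DFunLike.congr_fun hs c
  conv_rhs => rw [← h, pi_eq_sum_univ' (s c), map_sum]
  refine Finset.sum_congr rfl fun i _ => ?_
  rw [← map_smul]

theorem IsDualBasis.finite {A : Type*} {C : Type*} [Semiring A] [AddCommMonoid C] [Module A C]
    {ι : Type*} [Fintype ι] {e : ι → LeftDual A C} {x : ι → C} (h : IsDualBasis e x) :
    Module.Finite A C := by
  refine Module.Finite.of_surjective (Fintype.linearCombination A x) fun c =>
    ⟨fun i => (e i).toLin c, ?_⟩
  rw [Fintype.linearCombination_apply]
  exact h c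

theorem IsDualBasis.projective {A : Type*} {C : Type*} [Semiring A] [AddCommMonoid C] [Module A C]
    {ι : Type*} [Fintype ι] {e : ι → LeftDual A C} {x : ι → C} (h : IsDualBasis e x) :
    Module.Projective A C := by
  refine Module.Projective.of_split (M := ι → A) (LinearMap.pi fun i => (e i).toLin)
    (Fintype.linearCombination A x) (LinearMap.ext fun c => ?_)
  rw [LinearMap.comp_apply, Fintype.linearCombination_apply]
  exact h c

/-! ### Tensors determined by their evaluations -/

namespace Tens

theorem tmul_sum {A M N : Type*} [Semiring A] [AddCommMonoid M] [AddCommMonoid N]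
    [Module Aᵐᵒᵖ M] [Module A N] {ι : Type*} (s : Finset ι) (m : M) (n : ι → N) :
    tmul A m (∑ i ∈ s, n i) = ∑ i ∈ s, tmul A m (n i) :=
  map_sum (mkHom m : N →+ Tens A M N) n s

theorem exists_sum_tmul {A M N : Type*} [Semiring A] [AddCommMonoid M]
    [AddCommMonoid N] [Module Aᵐᵒᵖ M] [Module A N] (t : Tens A M N) :
    ∃ (n : ℕ) (m : Fin n → M) (x : Fin n → N), t = ∑ i, tmul A (m i) (x i) := by
  induction t using induction_on with
  | zero => exact ⟨0, Fin.elim0, Fin.elim0, by simp⟩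
  | tmul m x => exact ⟨1, fun _ => m, fun _ => x, by simp⟩
  | add s t hs ht =>
    obtain ⟨k, m, x, rfl⟩ := hs
    obtain ⟨l, m', x', rfl⟩ := ht
    exact ⟨k + l, Fin.append m m', Fin.append x x', by simp [Fin.sum_univ_add]⟩

/-- Elements of `M ⊗_A C` are recovered from their evaluations at a dual basis. -/
theorem sum_ev_tmul {A C : Type*} [Semiring A] [AddCommMonoid C] [Module A C]
    {ι : Type*} [Fintype ι] {e : ι → LeftDual A C} {x : ι → C} (h : IsDualBasis e x)
    {M : Type*} [AddCommMonoid M] [Module Aᵐᵒᵖ M] (t : Tens A M C) :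
    ∑ i, tmul A (ev M (e i).toLin t) (x i) = t := by
  induction t using induction_on with
  | zero => simp only [map_zero, zero_tmul, Finset.sum_const_zero]
  | tmul m c =>
    simp only [ev_tmul, smul_tmul]
    rw [← tmul_sum, h c]
  | add s t hs ht =>
    simp only [map_add, add_tmul, Finset.sum_add_distrib]
    rw [hs, ht]

/-- This is the injectivity of `alphaMap`; it reduces each identity between coactions to one between
actions. -/
theorem ev_ext {A C : Type*} [Semiring A] [AddCommMonoid C] [Module A C]
    {ι : Type*} [Fintype ι] {e : ι → LeftDual A C} {x : ι → C} (h : IsDualBasis e x)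
    {M : Type*} [AddCommMonoid M] [Module Aᵐᵒᵖ M] {s t : Tens A M C}
    (hst : ∀ f : LeftDual A C, ev M f.toLin s = ev M f.toLin t) : s = t := by
  rw [← sum_ev_tmul h s, ← sum_ev_tmul h t]
  simp only [hst]

/-- Evaluating at `f ⋆ g` amounts to comultiplying, then evaluating at `f` and `g`. -/
theorem ev_mul_eq {A C : Type*} [Semiring A] [AddCommMonoid C] [Module A C]
    [Module Aᵐᵒᵖ C] [SMulCommClass A Aᵐᵒᵖ C] [Semicoring A C]
    {M : Type*} [AddCommMonoid M] [Module Aᵐᵒᵖ M] (f g : LeftDual A C) (t : Tens A M C) :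
    ev M g.toLin (ev (Tens A M C) f.toLin
      (assoc.symm (map LinearMap.id (comul (A := A)) t))) = ev M (f * g).toLin t := by
  induction t using induction_on with
  | zero => simp only [map_zero]
  | add x y hx hy => simp only [map_add, hx, hy]
  | tmul m c =>
    rw [map_tmul, ev_tmul, LeftDual.mul_apply]
    change _ = op (g.toLin (ev C f.toLin (comul (A := A) c))) • m
    -- The identity is additive in the tensor and holds with any `s` in place of `Δ(c)`, so it
    -- suffices to check pure tensors.
    generalize comul (A := A) c = s
    induction s using induction_on with
    | zero => simp only [tmul_zero, map_zero, op_zero, zero_smul]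
    | add x y hx hy =>
      simp only [tmul_add, map_add, hx, hy, MulOpposite.op_add, add_smul]
    | tmul c c' => rfl

end Tens

/-! ### The base semiring inside the dual semiring -/

section dual

variable {A : Type*} {C : Type*} [Semiring A] [AddCommMonoid C] [Module A C]
  [Module Aᵐᵒᵖ C] [SMulCommClass A Aᵐᵒᵖ C] [Semicoring A C]

namespace LeftDual

theorem smul_apply (a : Aᵐᵒᵖ) (f : LeftDual A C) (c : C) : (a • f).toLin c = a • f.toLin c := rfl

/-- Right linearity of the counit gives `ε(c₁ f(c₂)) a = f(c) a`. Hence the right `A`-action on `*C`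
is right multiplication by `ε a`. -/
theorem mul_smul_counit (f : LeftDual A C) (a : Aᵐᵒᵖ) : f * a • 1 = a • f := by
  ext c
  rw [mul_apply, smul_apply, one_apply, counit_hit, smul_apply]

theorem mul_smul_right (f : LeftDual A C) (a : Aᵐᵒᵖ) (g : LeftDual A C) : f * a • g = a • (f * g) := rfl

theorem hit_smul_one (a : Aᵐᵒᵖ) (c : C) : hit (a • (1 : LeftDual A C)) c = a • c := by
  change Tens.ev C (a • (1 : LeftDual A C).toLin) (comul (A := A) c) = _
  rw [Tens.ev_smul]
  exact congrArg (a • ·) (hit_one c)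

variable (A C) in
/-- The semiring map `A → *C`, `a ↦ ε(-) a`, on opposites. -/
def ofBase : Aᵐᵒᵖ →+* (LeftDual A C)ᵐᵒᵖ where
  toFun a := op (a • 1)
  map_one' := by rw [one_smul, op_one]
  map_mul' a b := by rw [← op_mul, mul_smul_counit, mul_smul]
  map_zero' := by rw [zero_smul, op_zero]
  map_add' a b := by rw [add_smul, MulOpposite.op_add]

theorem ofBase_apply (a : Aᵐᵒᵖ) : ofBase A C a = op (a • (1 : LeftDual A C)) := rfl

end LeftDual

open LeftDual

/-- In a dual basis, `f = ∑ eᵢ f(xᵢ)`. -/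
theorem IsDualBasis.sum_smul {ι : Type*} [Fintype ι] {e : ι → LeftDual A C} {x : ι → C}
    (h : IsDualBasis e x) (f : LeftDual A C) : ∑ i, op (f.toLin (x i)) • e i = f := by
  ext c
  conv_rhs => rw [← h c, map_sum]
  refine (LinearMap.sum_apply _ _ _).trans (Finset.sum_congr rfl fun i _ => ?_)
  rw [map_smul]
  rfl

namespace Semicomod

theorem dualModule_smul (M : Semicomod A C) (f : LeftDual A C) (m : M.carrier) :
    letI := M.dualModule
    op f • m = Tens.ev M.carrier f.toLin (M.coact m) := rfl

/-- The action of `A` on a semicomodule is the restriction of that of `*C`. -/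
theorem ofBase_smul (M : Semicomod A C) (a : Aᵐᵒᵖ) (m : M.carrier) :
    letI := M.dualModule
    ofBase A C a • m = a • m := by
  change Tens.ev M.carrier (a • (1 : LeftDual A C).toLin) (M.coact m) = _
  rw [Tens.ev_smul]
  exact congrArg (a • ·) (M.counit m)

end Semicomod

end dual

/-! ### Semicomodules from `*C`-semimodules -/

namespace Semicomod

variable {A C : Type u} [Semiring A] [AddCommMonoid C] [Module A C]
  [Module Aᵐᵒᵖ C] [SMulCommClass A Aᵐᵒᵖ C] [Semicoring A C]
  {ι : Type*} [Fintype ι] {e : ι → LeftDual A C} {x : ι → C}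

open LeftDual

/-- The two `A`-structures are explicit variables so that semicomodules can be proved equal, not
merely isomorphic, as an isomorphism of categories requires. -/
theorem ext_of_ev (h : IsDualBasis e x) {X : Type w} [i : AddCommMonoid X]
    {m₁ m₂ : Module Aᵐᵒᵖ X}
    {ρ₁ : letI := m₁; X →ₗ[Aᵐᵒᵖ] Tens A X C} {ρ₂ : letI := m₂; X →ₗ[Aᵐᵒᵖ] Tens A X C}
    {a₁ a₂ b₁ b₂} (hm : m₁ = m₂)
    (hρ : ∀ (f : LeftDual A C) (m : X),
      (letI := m₁; Tens.ev X f.toLin (ρ₁ m)) = (letI := m₂; Tens.ev X f.toLin (ρ₂ m))) :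
    @Semicomod.mk A C _ _ _ _ _ _ X i m₁ ρ₁ a₁ b₁ =
      @Semicomod.mk A C _ _ _ _ _ _ X i m₂ ρ₂ a₂ b₂ := by
  subst hm
  have : ρ₁ = ρ₂ := LinearMap.ext fun m => Tens.ev_ext h fun f => hρ f m
  subst this
  rfl

/-- `m ↦ ∑ m eᵢ ⊗ xᵢ`. -/
def dualCoact (e : ι → LeftDual A C) (x : ι → C) (X : Type w) [AddCommMonoid X]
    [Module (LeftDual A C)ᵐᵒᵖ X] [Module Aᵐᵒᵖ X] (m : X) : Tens A X C :=
  ∑ i, Tens.tmul A (op (e i) • m) (x i)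

/-- The evaluation is `∑ m eᵢ (ε f(xᵢ)) = m ∑ eᵢ f(xᵢ)`, and the last sum is `f`. -/
theorem ev_dualCoact (h : IsDualBasis e x) (X : Type w) [AddCommMonoid X]
    [Module (LeftDual A C)ᵐᵒᵖ X] [Module Aᵐᵒᵖ X]
    (hX : ∀ (a : Aᵐᵒᵖ) (m : X), a • m = ofBase A C a • m) (f : LeftDual A C) (m : X) :
    Tens.ev X f.toLin (dualCoact e x X m) = op f • m := by
  unfold dualCoact
  simp only [map_sum, Tens.ev_tmul, hX, ← mul_smul, ofBase_apply, ← op_mul, mul_smul_counit]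
  rw [← Finset.sum_smul, ← Finset.op_sum, h.sum_smul]

/-- A right `*C`-semimodule as a right `C`-semicomodule, in the presence of a dual basis. -/
def ofDual (h : IsDualBasis e x) (X : SemimoduleCat.{w} (LeftDual A C)ᵐᵒᵖ) :
    Semicomod.{u, u, w} A C :=
  letI : Module Aᵐᵒᵖ X := Module.compHom X (ofBase A C)
  have hX : ∀ (a : Aᵐᵒᵖ) (m : X), a • m = ofBase A C a • m := fun _ _ => rfl
  have hev := ev_dualCoact h X hX
  { carrier := X
    coact :=
      { toFun := dualCoact e x X
        map_add' := fun m m' => Tens.ev_ext h fun f => by simp only [map_add, hev, smul_add]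
        map_smul' := fun a m => Tens.ev_ext h fun f => by
          -- On a pure tensor this says `f(c a) = ((ε a) ⋆ f)(c)`. The right action on the factor
          -- `C` thus becomes multiplication in `*C`.
          have h1 : ∀ t : Tens A X C, Tens.ev X f.toLin (a • t) =
              Tens.ev X ((a • (1 : LeftDual A C)) * f).toLin t := by
            intro t
            induction t using Tens.induction_on with
            | zero => simp only [smul_zero, map_zero]
            | add s t hs ht => simp only [smul_add, map_add, hs, ht]
            | tmul m c =>
              rw [Tens.smul_tmul_right, Tens.ev_tmul, Tens.ev_tmul, mul_apply, hit_smul_one]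
          rw [RingHom.id_apply, h1, hev, hev, hX, ofBase_apply, ← mul_smul, ← op_mul] }
    coassoc := fun m => by
      rw [← AddEquiv.eq_symm_apply]
      -- Evaluating the outer factor `C` at `f` and then the inner one at `g` reduces
      -- coassociativity to `m (f ⋆ g) = (m f) g`.
      refine Tens.ev_ext h fun f => Tens.ev_ext h fun g => ?_
      rw [Tens.ev_mul_eq, Tens.ev_map]
      change Tens.ev X g.toLin (dualCoact e x X (Tens.ev X f.toLin (dualCoact e x X m))) =
        Tens.ev X (f * g).toLin (dualCoact e x X m)
      rw [hev, hev, hev, ← mul_smul, ← op_mul]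
    counit := fun m => (hev 1 m).trans (by rw [op_one, one_smul]) }

/-- The carrier and addition are unchanged, so only the two `*C`-actions need comparing, and
`ev_dualCoact` identifies them. -/
theorem toDual_ofDual (h : IsDualBasis e x) (X : SemimoduleCat.{w} (LeftDual A C)ᵐᵒᵖ) :
    (ofDual h X).toDualObj = X := by
  have : (ofDual h X).dualModule = X.isModule := Module.ext' _ _ fun f m =>
    letI : Module Aᵐᵒᵖ X := Module.compHom X (ofBase A C)
    ev_dualCoact h X (fun _ _ => rfl) f.unop m
  exact congrArg (fun i => @SemimoduleCat.of (LeftDual A C)ᵐᵒᵖ _ X _ i) this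

theorem ofDual_toDual (h : IsDualBasis e x) (M : Semicomod.{u, u, w} A C) :
    ofDual h M.toDualObj = M := by
  refine ext_of_ev h ?_ fun f m => ?_
  · exact Module.ext' _ _ fun a m => M.ofBase_smul a m
  · letI := M.dualModule
    letI : Module Aᵐᵒᵖ M.carrier := Module.compHom M.carrier (ofBase A C)
    exact ev_dualCoact h M.carrier (fun _ _ => rfl) f m

/-! ### Full faithfulness, and the equality of categories from a dual basis -/

theorem toDual_map_injective (M N : Semicomod.{u, u, w} A C) :
    Function.Injective ((toDual.{u, u, w} A C).map : (M ⟶ N) → _) := fun _ _ hfg =>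
  Hom.ext (LinearMap.ext fun m => congrArg (fun k => SemimoduleCat.Hom.hom k m) hfg)

/-- A `*C`-linear map is `A`-linear because `A` acts through `ofBase`. It is colinear because, after
evaluation at `f`, colinearity reads `k(m) f = k(m f)`. -/
theorem toDual_map_surjective (h : IsDualBasis e x) (M N : Semicomod.{u, u, w} A C) :
    Function.Surjective ((toDual.{u, u, w} A C).map : (M ⟶ N) → _) := fun k => by
  letI := M.dualModule
  letI := N.dualModule
  let k' : M.carrier →ₗ[(LeftDual A C)ᵐᵒᵖ] N.carrier := k.hom
  let l : M.carrier →ₗ[Aᵐᵒᵖ] N.carrier :=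
    { toFun := k'
      map_add' := map_add k'
      map_smul' := fun a m => by
        rw [RingHom.id_apply, ← M.ofBase_smul, map_smul, N.ofBase_smul] }
  refine ⟨⟨l, fun m => Tens.ev_ext h fun f => ?_⟩, rfl⟩
  rw [Tens.ev_map]
  exact (k'.map_smul (op f) m).symm

theorem eqDual_of_isDualBasis (h : IsDualBasis e x) : EqDual.{u, u, w} A C :=
  ⟨⟨Function.LeftInverse.injective (g := ofDual h) (ofDual_toDual h),
    fun X => ⟨ofDual h X, toDual_ofDual h X⟩⟩,
    fun M N => ⟨toDual_map_injective M N, toDual_map_surjective h M N⟩⟩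

/-! ### The dual basis obtained from `𝕊^C = 𝕊_{*C}`

The coaction on the semicomodule `*C` at `ε` yields `e i`, `x i` with `f = ∑ eᵢ f(xᵢ)` for every
functional `f`. This is a dual basis because functionals separate points: the evaluation map
`C → Hom_{-A}(*C, A)` is colinear, and split by the coaction of its target followed by evaluation at
`ε`. No uniformity assumption on `C` or on the maps `α_M` enters. -/

theorem EqDual.closedUnderSub (h : EqDual.{u, u, w} A C) : ClosedUnderSub.{u, u, w} A C :=
  fun _ _ => h.1.2 _

/-- Every `*C`-semimodule is isomorphic to one underlying a semicomodule. -/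
theorem EqDual.exists_linearEquiv (h : EqDual.{u, u, w} A C) (X : Type w) [AddCommMonoid X]
    [Module (LeftDual A C)ᵐᵒᵖ X] :
    ∃ N : Semicomod.{u, u, w} A C,
      letI := N.dualModule
      Nonempty (N.carrier ≃ₗ[(LeftDual A C)ᵐᵒᵖ] X) := by
  obtain ⟨N, hN⟩ := h.1.2 (SemimoduleCat.of _ X)
  exact ⟨N, ⟨(CategoryTheory.eqToIso hN).toLinearEquivₛ⟩⟩

/-! ### Functionals separate points -/

variable (A C) in
/-- `C` as a right semicomodule over itself. -/
def regular : Semicomod.{u, u, u} A C where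
  carrier := C
  coact := comulR A C
  coassoc := Semicoring.coassoc
  counit := Semicoring.counit_right

/-- The right `*C`-semimodule structure `(φ f)(g) = φ(f ⋆ g)` on `Hom_{-A}(*C, A)`. -/
@[reducible]
def bidualModule : Module (LeftDual A C)ᵐᵒᵖ (LeftDual A C →ₗ[Aᵐᵒᵖ] A) where
  smul f φ :=
    { toFun := fun g => φ (f.unop * g)
      map_add' := fun g g' => by rw [mul_add, map_add]
      map_smul' := fun a g => by rw [mul_smul_right, map_smul, RingHom.id_apply] }
  one_smul φ := LinearMap.ext fun g => congrArg φ (one_mul g)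
  mul_smul f f' φ := LinearMap.ext fun g => congrArg φ (mul_assoc f'.unop f.unop g)
  smul_zero _ := rfl
  smul_add _ _ _ := rfl
  add_smul f f' φ := LinearMap.ext fun g =>
    (congrArg φ (add_mul f.unop f'.unop g)).trans (map_add φ _ _)
  zero_smul φ := LinearMap.ext fun g => (congrArg φ (zero_mul g)).trans (map_zero φ)

variable (A C) in
/-- The evaluation map `C → Hom_{-A}(*C, A)`, which is `*C`-linear. -/
def evalBidual :
    letI := (regular A C).dualModule
    letI := bidualModule (A := A) (C := C)
    (regular A C).carrier →ₗ[(LeftDual A C)ᵐᵒᵖ] (LeftDual A C →ₗ[Aᵐᵒᵖ] A) :=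
  letI := (regular A C).dualModule
  letI := bidualModule (A := A) (C := C)
  { toFun := fun c =>
      { toFun := fun f => f.toLin c
        map_add' := fun _ _ => rfl
        map_smul' := fun _ _ => rfl }
    map_add' := fun c c' => LinearMap.ext fun f => map_add f.toLin c c'
    map_smul' := fun _ _ => rfl }

/-- If `𝕊^C = 𝕊_{*C}`, then the left linear functionals on `C` separate points. -/
theorem EqDual.separating (h : EqDual.{u, u, u} A C) {c d : C}
    (hcd : ∀ f : LeftDual A C, f.toLin c = f.toLin d) : c = d := by
  letI := (regular A C).dualModule
  letI := bidualModule (A := A) (C := C)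
  obtain ⟨N, ⟨E⟩⟩ := h.exists_linearEquiv (LeftDual A C →ₗ[Aᵐᵒᵖ] A)
  letI := N.dualModule
  -- Fullness is used here: the `*C`-linear map `E⁻¹ ∘ eval` comes from a colinear `k`.
  obtain ⟨k, hk⟩ := (h.2 (regular A C) N).2
    (SemimoduleCat.ofHom (E.symm.toLinearMap ∘ₗ evalBidual A C))
  have hk' : ∀ c : (regular A C).carrier, k.toLin c = E.symm (evalBidual A C c) := fun c =>
    congrArg (fun k => SemimoduleCat.Hom.hom k c) hk
  -- Here `p` is evaluation at the unit `ε` of `*C`, transported along `E`. Since `eval(c)(ε) =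
  -- ε(c)`, composing it with `k` gives the counit.
  let p : N.carrier →ₗ[Aᵐᵒᵖ] A :=
    { toFun := fun n => E n 1
      map_add' := fun n n' => by rw [map_add]; rfl
      map_smul' := fun a n => by
        rw [← N.ofBase_smul, map_smul, RingHom.id_apply, ← (E n).map_smul]
        exact congrArg (E n) (mul_one _) }
  have hp : p ∘ₗ k.toLin = counitR A C := LinearMap.ext fun c => by
    exact DFunLike.congr_fun ((congrArg E (hk' c)).trans (E.apply_symm_apply _)) 1
  -- By colinearity, `(p ⊗ C)(ρ(k c)) = (p k ⊗ C)(Δ c) = ∑ ε(c₁) ⊗ c₂`, which the left counit law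
  -- sends to `c`. So `c` is recovered from `k c`, which depends only on the values of functionals
  -- at `c`.
  have hc : ∀ c : (regular A C).carrier, Tens.lid (Tens.map p LinearMap.id (N.coact (k.toLin c))) = c := fun c => by
    rw [k.colinear, Tens.map_map, hp]
    exact Semicoring.counit_left (A := A) (C := C) c
  have hkcd : k.toLin c = k.toLin d :=
    (hk' c).trans ((congrArg E.symm (LinearMap.ext hcd)).trans (hk' d).symm)
  exact (hc c).symm.trans ((congrArg (fun n => Tens.lid (Tens.map p LinearMap.id (N.coact n)))
    hkcd).trans (hc d))

/-- From `f = ∑ eᵢ f(xᵢ)` and left linearity of `f`, `f(∑ eᵢ(c) xᵢ) = ∑ eᵢ(c) f(xᵢ) = f(c)` for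
every `f`; separation of points concludes. -/
theorem EqDual.exists_isDualBasis (h : EqDual.{u, u, u} A C) :
    ∃ (n : ℕ) (e : Fin n → LeftDual A C) (x : Fin n → C), IsDualBasis e x := by
  obtain ⟨N, ⟨E⟩⟩ := h.exists_linearEquiv (LeftDual A C)
  letI := N.dualModule
  obtain ⟨n, m, x, ht⟩ := (N.coact (E.symm 1)).exists_sum_tmul
  refine ⟨n, fun i => E (m i), x, fun c => h.separating fun f => ?_⟩
  -- The action of `f` on the element corresponding to `ε` is read off from its coaction `∑ mᵢ ⊗
  -- xᵢ`.
  have hf : op f • E.symm 1 = ∑ i, op (f.toLin (x i)) • m i := by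
    rw [dualModule_smul, ht, map_sum]
    rfl
  have hf' : f = ∑ i, op (f.toLin (x i)) • E (m i) := by
    have := congrArg E hf
    rw [map_smul, E.apply_symm_apply, map_sum] at this
    refine (one_mul f).symm.trans (this.trans (Finset.sum_congr rfl fun i _ => ?_))
    -- `E` is only known to be `*C`-linear, so the scalar `f(xᵢ)` passes through it as the element
    -- `ε f(xᵢ)` of `*C`.
    rw [← N.ofBase_smul, map_smul]
    exact mul_smul_counit _ _
  conv_rhs => rw [hf']
  rw [map_sum]
  refine (Finset.sum_congr rfl fun i _ => ?_).trans (LinearMap.sum_apply _ _ _).symm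
  rw [map_smul]
  rfl

end Semicomod

/-! ### The main theorem -/

theorem mainTheorem3 (A C : Type u) [Semiring A] [AddCommMonoid C] [Module A C]
    [Module Aᵐᵒᵖ C] [SMulCommClass A Aᵐᵒᵖ C] [Semicoring A C]
    (hgen : UniformlyGenerated A C)
    (halpha : ∀ (M : Type u) [AddCommMonoid M] [Module Aᵐᵒᵖ M], IUniform (alphaMap A C M))
    (hprod : ∀ (Λ X Y : Type u) [AddCommMonoid X] [Module A X] [AddCommMonoid Y] [Module A Y]
      (f : X →ₗ[A] Y), IUniform f.toAddMonoidHom →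
        IUniform (Tens.map (LinearMap.id : (Λ → A) →ₗ[Aᵐᵒᵖ] (Λ → A)) f)) :
    Semicomod.EqDual.{u, u, u} A C ↔
      (Module.Finite A C ∧ Module.Projective A C) ∧ Semicomod.ClosedUnderSub.{u, u, u} A C := by
  constructor
  · intro h
    obtain ⟨n, e, x, hb⟩ := h.exists_isDualBasis
    exact ⟨⟨hb.finite, hb.projective⟩, h.closedUnderSub⟩
  · rintro ⟨⟨_, _⟩, -⟩
    obtain ⟨n, e, x, hb⟩ := exists_isDualBasis A C
    exact Semicomod.eqDual_of_isDualBasis hb
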